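/- Let $V$ be a (real or complex) Banach space and let $W$ be a linear subspace of $V$ (not assumed closed) whose algebraic (Hamel) dimension is $\dim(W)=\aleph_0$. Then $V\smallsetminus W$ is $(\alpha,\mathfrak c)$-spaceable for every cardinal $\alpha<\aleph_0$, where $\mathfrak c=\operatorname{card}(\mathbb R)$. Here, for cardinals $\alpha<\beta$, a subset $A$ of a topological vector space $E$ is called $(\alpha,\beta)$-spaceable if 1. $A$ is $\alpha$-lineable, that is, there is a linear subspace $F\subset E$ with $\dim(F)=\alpha$ and $F\smallsetminus\{0\}\subset A$; and 2. for every linear subspace $F_\alpha\subset E$ with $\dim(F_\alpha)=\alpha$ and $F_\alpha\subset A\cup\{0\}$ there is a closed linear subspace $F_\beta\subset E$ with $\dim(F_\beta)=\beta$ and $F_\alpha\subset F_\beta\subset A\cup\{0\}$. All dimensions are algebraic (Hamel) dimensions. -/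

import Mathlib

universe u v

namespace Spaceability

variable (𝕜 : Type v) {E : Type u} [Field 𝕜] [AddCommGroup E] [Module 𝕜 E]

/-- A subset `A` of a vector space is `β`-lineable if there is a subspace `F` with `dim F = β`
and `F ∖ {0} ⊆ A`. -/
def IsLineable (β : Cardinal.{u}) (A : Set E) : Prop :=
  ∃ F : Submodule 𝕜 E, Module.rank 𝕜 F = β ∧ (F : Set E) \ {0} ⊆ A

/-- A subset `A` of a topological vector space is `(α, β)`-spaceable (used for `α < β`) if it is
`α`-lineable and every `α`-dimensional subspace contained in `A ∪ {0}` is contained in a closed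
`β`-dimensional subspace that is itself contained in `A ∪ {0}`. -/
def IsPairSpaceable [TopologicalSpace E] (α β : Cardinal.{u}) (A : Set E) : Prop :=
  IsLineable 𝕜 α A ∧
    ∀ F : Submodule 𝕜 E, (F : Set E) ⊆ A ∪ {0} → Module.rank 𝕜 F = α →
      ∃ G : Submodule 𝕜 E, Module.rank 𝕜 G = β ∧ IsClosed (G : Set E) ∧
        F ≤ G ∧ (G : Set E) ⊆ A ∪ {0}

end Spaceability

namespace Spaceability

open Cardinal Set

section

variable {𝕜 : Type v} [RCLike 𝕜] {V : Type u} [NormedAddCommGroup V] [NormedSpace 𝕜 V]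

/-! Write `W` as a countable union of finite-dimensional `Y n`. Starting from `F`, grow
finite-dimensional `X n` disjoint from `W` inside shrinking closed subspaces `K n` of finite
codimension, with `K (n + 1)` disjoint from `Y n`. The closure of `⋃ X n` lies in every `K n`, hence
misses `W`. A new vector is always available: `K n` has dimension at least `𝔠`, while `X n ⊔ W` has
countable dimension. The closure is a separable infinite-dimensional Banach space, so its dimension
is exactly `𝔠`: separability bounds its cardinality, and the sums `∑ tⁿ xₙ`, `0 < t < 1`, along a
triangular sequence are linearly independent. -/

/-- An infinite-dimensional normed space contains a bounded sequence that is triangular with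
respect to a sequence of continuous functionals. -/
theorem exists_triangular_seq (hV : ¬ FiniteDimensional 𝕜 V) :
    ∃ (x : ℕ → V) (f : ℕ → StrongDual 𝕜 V), (∀ n, ‖x n‖ ≤ 1) ∧ (∀ n, f n (x n) ≠ 0) ∧
      ∀ m n, m < n → f m (x n) = 0 := by
  have step : ∀ K : {K : Submodule 𝕜 V // K.CoFG}, ∃ p : V × StrongDual 𝕜 V,
      p.1 ∈ K.1 ∧ ‖p.1‖ ≤ 1 ∧ p.2 p.1 ≠ 0 := by
    rintro ⟨K, hK⟩
    have hne : K ≠ ⊥ := by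
      rintro rfl
      exact hV ((Module.Finite.iff_cofg_bot 𝕜 V).mp hK)
    obtain ⟨y, hy, hy0⟩ := K.exists_mem_ne_zero_of_ne_bot hne
    have hn : ‖y‖ ≠ 0 := norm_ne_zero_iff.mpr hy0
    obtain ⟨g, -, hg⟩ := exists_dual_vector 𝕜 y hn
    refine ⟨(((‖y‖⁻¹ : ℝ) : 𝕜) • y, g), K.smul_mem _ hy, ?_, ?_⟩
    · rw [norm_smul, RCLike.norm_ofReal, abs_inv, abs_norm, inv_mul_cancel₀ hn]
    · simp [hg, hy0]
  choose p hpK hp1 hp0 using step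
  let K : ℕ → {K : Submodule 𝕜 V // K.CoFG} := fun n ↦
    Nat.rec ⟨⊤, Submodule.CoFG.top⟩
      (fun _ K ↦ ⟨K.1 ⊓ LinearMap.ker (p K).2.toLinearMap,
        Submodule.CoFG.inf K.2 (Submodule.CoFG.ker _)⟩) n
  have hK : ∀ n, (K (n + 1)).1 = (K n).1 ⊓ LinearMap.ker (p (K n)).2.toLinearMap := fun _ ↦ rfl
  have hanti : Antitone fun n ↦ (K n).1 := antitone_nat_of_succ_le fun n ↦ by
    rw [hK]; exact inf_le_left
  refine ⟨fun n ↦ (p (K n)).1, fun n ↦ (p (K n)).2, fun n ↦ hp1 _, fun n ↦ hp0 _, ?_⟩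
  intro m n hmn
  have h1 : (p (K n)).1 ∈ (K (m + 1)).1 := hanti (Nat.succ_le_of_lt hmn) (hpK (K n))
  rw [hK] at h1
  exact h1.2

/-- A convergent series along a triangular sequence determines its coefficients. -/
theorem coeff_eq_zero_of_hasSum_zero {x : ℕ → V} {f : ℕ → StrongDual 𝕜 V}
    (hd : ∀ n, f n (x n) ≠ 0) (ht : ∀ m n, m < n → f m (x n) = 0) {a : ℕ → 𝕜}
    (ha : HasSum (fun n ↦ a n • x n) 0) (n : ℕ) : a n = 0 := by
  induction n using Nat.strong_induction_on with
  | _ n ih =>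
    have h1 : HasSum (fun k ↦ f n (a k • x k)) 0 := by
      simpa using (f n).hasSum ha
    have h2 : HasSum (fun k ↦ f n (a k • x k)) (f n (a n • x n)) := by
      refine hasSum_single n fun k hk ↦ ?_
      rcases lt_or_gt_of_ne hk with h | h
      · simp [ih k h]
      · simp [ht n k h]
    have h3 := h1.unique h2
    rw [map_smul, smul_eq_mul, eq_comm, mul_eq_zero] at h3
    exact h3.resolve_right (hd n)

/-- Distinct geometric sequences are linearly independent. -/
theorem linearIndependent_geometric :
    LinearIndependent 𝕜 fun (t : Ioo (0 : ℝ) 1) (n : ℕ) ↦ ((t : ℝ) : 𝕜) ^ n := by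
  -- Geometric sequences are characters of the monoid `ℕ`, so Dedekind's independence theorem
  -- applies.
  have h := (linearIndependent_monoidHom (Multiplicative ℕ) 𝕜).comp
    (fun t : Ioo (0 : ℝ) 1 ↦ powersHom 𝕜 ((t : ℝ) : 𝕜)) fun s t hst ↦ by
      have := (powersHom 𝕜).injective hst
      exact Subtype.ext (RCLike.ofReal_injective this)
  exact h

/-- An infinite-dimensional Banach space has algebraic dimension at least the continuum. -/
theorem continuum_le_rank [CompleteSpace V] (hV : ¬ FiniteDimensional 𝕜 V) :
    𝔠 ≤ Module.rank 𝕜 V := by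
  obtain ⟨x, f, hx, hd, ht⟩ := exists_triangular_seq hV
  have hs : ∀ t : Ioo (0 : ℝ) 1, Summable fun n ↦ ((t : ℝ) : 𝕜) ^ n • x n := by
    intro t
    refine Summable.of_norm_bounded (summable_geometric_of_lt_one t.2.1.le t.2.2) fun n ↦ ?_
    rw [norm_smul, norm_pow, RCLike.norm_ofReal, abs_of_pos t.2.1]
    exact mul_le_of_le_one_right (pow_nonneg t.2.1.le n) (hx n)
  have hli : LinearIndependent 𝕜
      fun t : Ioo (0 : ℝ) 1 ↦ ∑' n, ((t : ℝ) : 𝕜) ^ n • x n := by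
    rw [linearIndependent_iff']
    intro s g hg
    have hsum : HasSum (fun n ↦ (∑ t ∈ s, g t * ((t : ℝ) : 𝕜) ^ n) • x n) 0 := by
      rw [← hg]
      have := hasSum_sum fun t (_ : t ∈ s) ↦ (hs t).hasSum.const_smul (g t)
      simpa only [Finset.sum_smul, mul_smul] using this
    refine linearIndependent_iff'.mp (linearIndependent_geometric (𝕜 := 𝕜)) s g ?_
    ext n
    simpa using coeff_eq_zero_of_hasSum_zero hd ht hsum n
  have h := hli.cardinal_lift_le_rank
  rw [mk_Ioo_real zero_lt_one, lift_continuum] at h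
  simpa using h

/-- A second-countable T₀ space has at most continuum many points. -/
theorem mk_le_continuum_of_secondCountable (X : Type u) [TopologicalSpace X] [T0Space X]
    [SecondCountableTopology X] : #X ≤ 𝔠 := by
  let φ : X → Set (TopologicalSpace.countableBasis X) := fun x ↦ {B | x ∈ B.1}
  have hφ : Function.Injective φ := fun x y hxy ↦ by
    refine ((TopologicalSpace.isBasis_countableBasis X).inseparable_iff.mpr fun B hB ↦ ?_).eq
    exact Set.ext_iff.mp hxy ⟨B, hB⟩
  refine (mk_le_of_injective hφ).trans ?_
  rw [mk_set, ← two_power_aleph0]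
  exact power_le_power_left two_ne_zero
    (mk_le_aleph0_iff.mpr (TopologicalSpace.countable_countableBasis X).to_subtype)

/-- Two disjoint finite-dimensional subspaces are separated by a closed subspace of finite
codimension: it contains the first and is disjoint from the second. -/
theorem exists_closed_cofg_of_disjoint (X Y : Submodule 𝕜 V) [FiniteDimensional 𝕜 X]
    [FiniteDimensional 𝕜 Y] (h : Disjoint X Y) :
    ∃ L : Submodule 𝕜 V, IsClosed (L : Set V) ∧ L.CoFG ∧ X ≤ L ∧ Disjoint L Y := by
  obtain ⟨C, hXC, hC⟩ := h.exists_isCompl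
  -- `P` may be discontinuous. Only its restriction to the finite-dimensional `X ⊔ Y` is used, and
  -- that extends continuously.
  let P : V →ₗ[𝕜] Y := Y.projectionOnto C hC.symm
  obtain ⟨Q, hQ⟩ := ContinuousLinearMap.exist_extension_of_finiteDimensional_range
    (LinearMap.toContinuousLinearMap (P.domRestrict (X ⊔ Y)))
  have hQP : ∀ z ∈ X ⊔ Y, Q z = P z := fun z hz ↦
    (DFunLike.congr_fun hQ (⟨z, hz⟩ : ↥(X ⊔ Y))).symm
  refine ⟨LinearMap.ker Q.toLinearMap, Q.isClosed_ker, Submodule.CoFG.ker _, ?_, ?_⟩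
  · intro z hz
    change Q z = 0
    rw [hQP z (Submodule.mem_sup_left hz)]
    exact (Submodule.projectionOnto_apply_eq_zero_iff hC.symm).mpr (hXC hz)
  · rw [Submodule.disjoint_def]
    intro z hz hzY
    have h1 : P z = 0 := by
      rw [← hQP z (Submodule.mem_sup_right hzY)]
      exact hz
    have h2 := Submodule.projectionOnto_apply_left hC.symm ⟨z, hzY⟩
    exact congrArg Subtype.val (h2.symm.trans h1)

/-- A subspace of countable dimension is a countable union of finite-dimensional ones. -/
theorem exists_seq_finiteDimensional (W : Submodule 𝕜 V) (hW : Module.rank 𝕜 W ≤ ℵ₀) :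
    ∃ Y : ℕ → Submodule 𝕜 V, (∀ n, FiniteDimensional 𝕜 (Y n)) ∧ (∀ n, Y n ≤ W) ∧
      ∀ w ∈ W, ∃ n, w ∈ Y n := by
  let b := Module.Basis.ofVectorSpace 𝕜 W
  have hc : Countable (Module.Basis.ofVectorSpaceIndex 𝕜 W) := by
    rw [← mk_le_aleph0_iff, b.mk_eq_rank'']
    exact hW
  obtain ⟨e, he⟩ := exists_surjective_nat (Finset (Module.Basis.ofVectorSpaceIndex 𝕜 W))
  refine ⟨fun n ↦ (Submodule.span 𝕜 (b '' (e n : Set _))).map W.subtype, fun n ↦ ?_,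
    fun n ↦ Submodule.map_subtype_le _ _, fun w hw ↦ ?_⟩
  · have := FiniteDimensional.span_of_finite 𝕜 ((e n).finite_toSet.image b)
    infer_instance
  · obtain ⟨n, hn⟩ := he (b.repr ⟨w, hw⟩).support
    refine ⟨n, ⟨w, hw⟩, ?_, rfl⟩
    rw [hn]
    exact b.mem_span_repr_support _

/-- A closed subspace of finite codimension in an infinite-dimensional Banach space is not
contained in a subspace of countable dimension. -/
theorem exists_mem_notMem_of_cofg [CompleteSpace V] (hV : ¬ FiniteDimensional 𝕜 V)
    {K U : Submodule 𝕜 V} (hK : K.CoFG) (hU : Module.rank 𝕜 U ≤ ℵ₀) : ∃ x ∈ K, x ∉ U := by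
  by_contra! h
  have h1 : Module.rank 𝕜 K ≤ ℵ₀ := (Submodule.rank_mono h).trans hU
  have h2 : Module.rank 𝕜 (V ⧸ K) ≤ ℵ₀ := (Module.rank_lt_aleph0 𝕜 (V ⧸ K)).le
  have h3 := continuum_le_rank hV
  rw [← Submodule.rank_quotient_add_rank K] at h3
  exact absurd (h3.trans (add_le_aleph0.mpr ⟨h2, h1⟩)) (not_le.mpr aleph0_lt_continuum)

/-- A finite-dimensional subspace `F` disjoint from a subspace `W` of countable dimension is
contained in a closed subspace of dimension the continuum that is disjoint from `W`. -/
theorem exists_closed_rank_continuum [CompleteSpace V] (hV : ¬ FiniteDimensional 𝕜 V)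
    (W F : Submodule 𝕜 V) (hW : Module.rank 𝕜 W ≤ ℵ₀) [FiniteDimensional 𝕜 F]
    (hFW : Disjoint F W) :
    ∃ G : Submodule 𝕜 V, Module.rank 𝕜 G = 𝔠 ∧ IsClosed (G : Set V) ∧ F ≤ G ∧ Disjoint G W := by
  obtain ⟨Y, hYfin, hYW, hWY⟩ := exists_seq_finiteDimensional W hW
  let State := {p : Submodule 𝕜 V × Submodule 𝕜 V // FiniteDimensional 𝕜 p.1 ∧
    IsClosed (p.2 : Set V) ∧ p.2.CoFG ∧ p.1 ≤ p.2 ∧ Disjoint p.1 W}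
  have step : ∀ (n : ℕ) (s : State), ∃ s' : State, s.1.1 < s'.1.1 ∧ s'.1.2 ≤ s.1.2 ∧
      Disjoint s'.1.2 (Y n) := by
    rintro n ⟨⟨X, K⟩, hX, hKc, hK, hXK, hXW⟩
    dsimp only at hX hKc hK hXK hXW
    have := hYfin n
    obtain ⟨L, hLc, hL, hXL, hLY⟩ :=
      exists_closed_cofg_of_disjoint X (Y n) (hXW.mono_right (hYW n))
    have hrank : Module.rank 𝕜 ↥(X ⊔ W) ≤ ℵ₀ :=
      (Submodule.rank_add_le_rank_add_rank X W).trans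
        (add_le_aleph0.mpr ⟨(Module.rank_lt_aleph0 𝕜 X).le, hW⟩)
    -- Avoiding `X ⊔ W`, and not just `W`, makes the enlarged space both strictly bigger and still
    -- disjoint from `W`.
    obtain ⟨x, hx, hxU⟩ := exists_mem_notMem_of_cofg hV (Submodule.CoFG.inf hK hL) hrank
    refine ⟨⟨(X ⊔ 𝕜 ∙ x, K ⊓ L), inferInstance, ?_, Submodule.CoFG.inf hK hL, ?_, ?_⟩,
      ?_, inf_le_left, hLY.mono_left inf_le_right⟩
    · exact hKc.inter hLc
    · exact sup_le (le_inf hXK hXL) ((Submodule.span_singleton_le_iff_mem _ _).mpr hx)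
    · refine (hXW.symm.disjoint_sup_right_of_disjoint_sup_left ?_).symm
      rw [sup_comm, Submodule.disjoint_span_singleton]
      exact fun h ↦ absurd h hxU
    · refine lt_of_le_of_ne le_sup_left fun h ↦ hxU (Submodule.mem_sup_left ?_)
      dsimp only at h
      rw [h]
      exact Submodule.mem_sup_right (Submodule.mem_span_singleton_self x)
  choose next hlt hle hdis using step
  let S : ℕ → State := fun n ↦
    Nat.rec ⟨(F, ⊤), inferInstance, isClosed_univ, Submodule.CoFG.top, le_top, hFW⟩ next n
  have hX : StrictMono fun n ↦ (S n).1.1 := strictMono_nat_of_lt_succ fun n ↦ hlt n (S n)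
  have hK : Antitone fun n ↦ (S n).1.2 := antitone_nat_of_succ_le fun n ↦ hle n (S n)
  have hXK : ∀ m n, (S m).1.1 ≤ (S n).1.2 := fun m n ↦
    (hX.monotone (le_max_left m n)).trans
      ((S (max m n)).2.2.2.2.1.trans (hK (le_max_right m n)))
  let U : Submodule 𝕜 V := ⨆ n, (S n).1.1
  have hUG : U ≤ U.topologicalClosure := U.le_topologicalClosure
  have hGinf : ¬ FiniteDimensional 𝕜 U.topologicalClosure := by
    intro hfin
    have hmono : StrictMono fun n ↦ Module.finrank 𝕜 (S n).1.1 := fun m n hmn ↦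
      have := (S n).2.1
      Submodule.finrank_lt_finrank_of_lt (hX hmn)
    -- Strict growth gives `n ≤ finrank (X n)`; take `n` one above the supposed dimension of the
    -- closure.
    exact absurd (hmono.le_apply (x := Module.finrank 𝕜 U.topologicalClosure + 1))
      (not_le.mpr (Nat.lt_succ_of_le (Submodule.finrank_mono
        ((le_iSup (fun n ↦ (S n).1.1) (Module.finrank 𝕜 U.topologicalClosure + 1)).trans hUG))))
  refine ⟨U.topologicalClosure, le_antisymm ?_ ?_, U.isClosed_topologicalClosure,
    (le_iSup (fun n ↦ (S n).1.1) 0).trans hUG, ?_⟩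
  · have hsep : TopologicalSpace.IsSeparable (U.topologicalClosure : Set V) := by
      rw [Submodule.topologicalClosure_coe, TopologicalSpace.isSeparable_closure,
        Submodule.coe_iSup_of_directed _ hX.monotone.directed_le]
      refine TopologicalSpace.IsSeparable.iUnion fun n ↦ ?_
      have := (S n).2.1
      have := FiniteDimensional.proper 𝕜 (S n).1.1
      exact TopologicalSpace.IsSeparable.of_subtype _
    have := hsep.separableSpace
    have := UniformSpace.secondCountable_of_separable U.topologicalClosure
    exact (rank_le_card 𝕜 _).trans (mk_le_continuum_of_secondCountable _)
  · have : CompleteSpace U.topologicalClosure :=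
      U.isClosed_topologicalClosure.completeSpace_coe
    exact continuum_le_rank hGinf
  · rw [Submodule.disjoint_def]
    intro z hz hzW
    obtain ⟨n, hn⟩ := hWY z hzW
    have hzK : U.topologicalClosure ≤ (S (n + 1)).1.2 :=
      U.topologicalClosure_minimal (iSup_le fun m ↦ hXK m (n + 1)) (S (n + 1)).2.2.1
    exact Submodule.disjoint_def.mp (hdis n (S n)) z (hzK hz) hn

end

/-- The complement of a subspace contains a subspace, up to zero, iff the two are disjoint. -/
theorem subset_compl_union_zero_iff {𝕜 : Type v} {V : Type u} [Field 𝕜] [AddCommGroup V]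
    [Module 𝕜 V] {W G : Submodule 𝕜 V} :
    (G : Set V) ⊆ (univ \ (W : Set V)) ∪ {0} ↔ Disjoint G W := by
  rw [Submodule.disjoint_def]
  constructor
  · intro h x hx hxW
    exact (h hx).resolve_left fun h' ↦ h'.2 hxW
  · intro h x hx
    by_cases hxW : x ∈ W
    · exact Or.inr (h x hx hxW)
    · exact Or.inl ⟨mem_univ x, hxW⟩

end Spaceability

theorem mainTheorem6 {𝕜 : Type v} [RCLike 𝕜] {V : Type u} [NormedAddCommGroup V]
    [NormedSpace 𝕜 V] [CompleteSpace V] (W : Submodule 𝕜 V)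
    (hW : Module.rank 𝕜 W = Cardinal.aleph0.{u}) (α : Cardinal.{u})
    (hα : α < Cardinal.aleph0.{u}) :
    Spaceability.IsPairSpaceable 𝕜 α Cardinal.continuum.{u} (Set.univ \ (W : Set V)) := by
  have hV : ¬ FiniteDimensional 𝕜 V := fun h ↦
    (Module.rank_lt_aleph0 𝕜 W).ne hW
  refine ⟨?_, fun F hF hrank ↦ ?_⟩
  -- Lineability: apply the construction to `⊥` and take an `α`-dimensional subspace of the result.
  · obtain ⟨G, hG, -, -, hGW⟩ := Spaceability.exists_closed_rank_continuum hV W ⊥ hW.le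
      disjoint_bot_left
    have hle : α ≤ Module.rank 𝕜 G := by
      rw [hG]
      exact (hα.trans Cardinal.aleph0_lt_continuum).le
    obtain ⟨s, hs, hli⟩ := le_rank_iff_exists_linearIndependent.mp hle
    refine ⟨(Submodule.span 𝕜 s).map G.subtype, ?_, ?_⟩
    · rw [(Submodule.equivMapOfInjective G.subtype G.injective_subtype _).symm.rank_eq,
        rank_span_set hli, hs]
    · rw [Set.sdiff_subset_iff, Set.union_comm]
      exact Spaceability.subset_compl_union_zero_iff.mpr
        (hGW.mono_left (Submodule.map_subtype_le _ _))
  · have : FiniteDimensional 𝕜 F := Module.rank_lt_aleph0_iff.mp (hrank ▸ hα)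
    obtain ⟨G, hG, hGc, hFG, hGW⟩ := Spaceability.exists_closed_rank_continuum hV W F hW.le
      (Spaceability.subset_compl_union_zero_iff.mp hF)
    exact ⟨G, hG, hGc, hFG, Spaceability.subset_compl_union_zero_iff.mpr hGW⟩
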